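/- For integers $k_1\ge 2$, $k_2\ge 1$ and $a_1,a_2\in\mathbb{Z}/2\mathbb{Z}$, let $$\zeta_2(k_1,k_2;a_1,a_2)=\sum_{\substack{m_1>m_2>0\\ m_1\equiv a_1,\ m_2\equiv a_2\ (\mathrm{mod}\ 2)}}\frac{4}{m_1^{k_1}m_2^{k_2}}$$ be the double zeta values of level $2$, and write $\zeta_2(k_1,k_2)=\zeta_2(k_1,k_2;0,0)$ and $\zeta_2(k_1,\overline{k_2})=\zeta_2(k_1,k_2;0,1)$. Let $\zeta$ be the Riemann zeta function, and let $T(k_1,k_2)=4\sum 1/(m_1^{k_1}m_2^{k_2})$, summed over $m_1>m_2>0$ with $m_1$ even and $m_2$ odd, and $T(k)=2\sum_{m>0,\ m\text{ odd}} 1/m^{k}$ be the Kaneko–Tsumura $T$-values. Then for every integer $k\ge 3$ all the series involved, including $\zeta_2(j,k-j;a_1,a_2)$ for all $2\le j\le k-1$ and $a_1,a_2$ and $\sum_{m>0,\ m\equiv a\ (\mathrm{mod}\ 2)}2/m^k$ for both $a$, converge absolutely, and $$\sum_{j=2}^{k-1}2^j\,\zeta_2(j,k-j)=\frac{k+1}{2^{k-2}}\,\zeta(k),\qquad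 \sum_{j=2}^{k-1}2^j\,\zeta_2(j,\overline{k-j})=4(k-1)\Bigl(1-\frac1{2^k}\Bigr)\zeta(k).$$ In particular, the Kaneko–Tsumura weighted sum formula holds: $$\sum_{j=2}^{k-1}2^{j-1}\,T(j,k-j)=(k-1)\,T(k).$$ -/

import Mathlib

open scoped BigOperators

noncomputable section

/-- The index set `m₁ > ⋯ > mₙ > 0`, `mᵢ ≡ aᵢ (mod N)`. -/
def levelIndex (N : ℕ) {n : ℕ} (a : Fin n → ZMod N) : Set (Fin n → ℕ) :=
  {m | StrictAnti m ∧ (∀ i, 0 < m i) ∧ ∀ i, (m i : ZMod N) = a i}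

/-- The summand `Nⁿ / (m₁^{k₁} ⋯ mₙ^{kₙ})`. -/
def levelTerm (N : ℕ) {n : ℕ} (k : Fin n → ℕ) (m : Fin n → ℕ) : ℝ :=
  (N : ℝ) ^ n / ∏ i, (m i : ℝ) ^ k i

/-- (Absolute) convergence of the series defining `ζ_N(k₁,…,kₙ; a₁,…,aₙ)`. -/
def LevelConverges (N : ℕ) {n : ℕ} (k : Fin n → ℕ) (a : Fin n → ZMod N) : Prop :=
  Summable fun m : levelIndex N a => levelTerm N k m

/-- The multiple zeta value of level `N`, `ζ_N(k₁,…,kₙ; a₁,…,aₙ)`. -/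
def levelZeta (N : ℕ) {n : ℕ} (k : Fin n → ℕ) (a : Fin n → ZMod N) : ℝ :=
  ∑' m : levelIndex N a, levelTerm N k m

/-- The Kaneko–Tsumura multiple `T`-value, with the largest summation variable first:
`T(k₁,…,kₙ) = 2ⁿ ∑ 1 / (m₁^{k₁} ⋯ mₙ^{kₙ})` over `m₁ > ⋯ > mₙ > 0` with
`mᵢ ≡ n - i + 1 (mod 2)`; so `mₙ` is odd, `mₙ₋₁` even, and so on. -/
def multipleT {n : ℕ} (k : Fin n → ℕ) : ℝ :=
  levelZeta 2 k (fun i => ((n - (i : ℕ) : ℕ) : ZMod 2))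

end

open Filter Topology Finset

section Summability

/-! Since `m₁` is even, `p = m₁ - m₂` and `q = m₂` range independently over the positive integers of
one parity class, `2 r + c` with `c = 1` or `2`. The domain is thus symmetric in `p` and `q`. With
`k = n + 2`, the weights `2 ^ j` make the sum over `j` geometric (`sum_two_pow_div`). Its term in
`(2 / (p + q)) ^ (n + 1)` carries the factor `1 / (q - p)`, so it is antisymmetric and cancels on
symmetrising (`sum_two_pow_symm`).

What remains is a diagonal term and `1 / p ^ (n + 1)` times the sum over `q` of `1 / (q - p) - 1 /
(q + p)`, together with its mirror image. Over a square of side `N` the inner sum is a difference of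
harmonic numbers tending to `(c - 1) / p` (`abs_inner_sum_le`), and the accumulated errors vanish
(`tsum`-free limit in `tendsto_sum_inner`). Absolute convergence allows summation over squares, so
the total is a multiple of `∑ 1 / p ^ k`, hence of `ζ(k)`. -/

theorem levelConverges_one {k : ℕ} (hk : 2 ≤ k) (N : ℕ) (a : Fin 1 → ZMod N) :
    LevelConverges N ![k] a := by
  have h : Summable fun n : ℕ => (N : ℝ) * (1 / (n : ℝ) ^ k) :=
    (Real.summable_one_div_nat_pow.2 (by omega)).mul_left _
  have hinj : Function.Injective fun m : levelIndex N a => (m : Fin 1 → ℕ) 0 := by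
    intro m m' hm
    ext i
    fin_cases i
    exact hm
  refine (h.comp_injective hinj).congr fun m => ?_
  simp [levelTerm, div_eq_mul_inv]

/-- As `n ≤ m`, half a power of `m` can be traded for one of `n`, so `m ^ 2 * n ≥ (m * n) ^ (3 /
2)`; both exponents now exceed 1. -/
theorem one_div_pow_mul_pow_le {i l m n : ℕ} (hi : 2 ≤ i) (hl : 1 ≤ l) (hn : 0 < n)
    (hnm : n ≤ m) :
    1 / ((m : ℝ) ^ i * (n : ℝ) ^ l) ≤
      1 / (m : ℝ) ^ (3 / 2 : ℝ) * (1 / (n : ℝ) ^ (3 / 2 : ℝ)) := by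
  have hn1 : (1 : ℝ) ≤ n := by exact_mod_cast hn
  have hnm' : (n : ℝ) ≤ m := by exact_mod_cast hnm
  have hm1 : (1 : ℝ) ≤ m := hn1.trans hnm'
  rw [div_mul_div_comm, one_mul]
  refine one_div_le_one_div_of_le (by positivity) ?_
  have e1 : (m : ℝ) ^ 2 = (m : ℝ) ^ (3 / 2 : ℝ) * (m : ℝ) ^ (1 / 2 : ℝ) := by
    rw [← Real.rpow_add (by positivity), ← Real.rpow_natCast]
    norm_num
  have e2 : (n : ℝ) ^ (3 / 2 : ℝ) = (n : ℝ) ^ (1 / 2 : ℝ) * n := by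
    nth_rewrite 3 [← Real.rpow_one (n : ℝ)]
    rw [← Real.rpow_add (by positivity)]
    norm_num
  calc (m : ℝ) ^ (3 / 2 : ℝ) * (n : ℝ) ^ (3 / 2 : ℝ)
      = (m : ℝ) ^ (3 / 2 : ℝ) * (n : ℝ) ^ (1 / 2 : ℝ) * n := by rw [e2, mul_assoc]
    _ ≤ (m : ℝ) ^ (3 / 2 : ℝ) * (m : ℝ) ^ (1 / 2 : ℝ) * n := by gcongr
    _ = (m : ℝ) ^ 2 * n := by rw [e1]
    _ ≤ (m : ℝ) ^ i * (n : ℝ) ^ l := by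
        exact mul_le_mul (pow_le_pow_right₀ hm1 hi) (le_self_pow₀ hn1 (by omega)) (by positivity)
          (by positivity)

theorem levelConverges_two {i l : ℕ} (hi : 2 ≤ i) (hl : 1 ≤ l) (N : ℕ) (a : Fin 2 → ZMod N) :
    LevelConverges N ![i, l] a := by
  have h1 : Summable fun n : ℕ => 1 / (n : ℝ) ^ (3 / 2 : ℝ) :=
    Real.summable_one_div_nat_rpow.2 (by norm_num)
  have h2 := (h1.mul_of_nonneg h1 (fun n => by positivity) (fun n => by positivity)).mul_left
    ((N : ℝ) ^ 2)
  have hinj : Function.Injective fun m : levelIndex N a =>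
      ((m : Fin 2 → ℕ) 0, (m : Fin 2 → ℕ) 1) := by
    intro m m' hm
    ext i
    fin_cases i
    · exact congrArg Prod.fst hm
    · exact congrArg Prod.snd hm
  refine Summable.of_nonneg_of_le (fun m => ?_) (fun m => ?_) (h2.comp_injective hinj)
  · rw [levelTerm]
    positivity
  · have hlt : (m : Fin 2 → ℕ) 1 < (m : Fin 2 → ℕ) 0 := m.2.1 (by simp)
    have := one_div_pow_mul_pow_le hi hl (m.2.2.1 1) hlt.le
    simp only [levelTerm, Fin.prod_univ_two, Function.comp, Matrix.cons_val_zero,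
      Matrix.cons_val_one]
    rw [div_eq_mul_one_div]
    gcongr

end Summability

/-! ### Parametrising the index sets by natural numbers -/

section Reindexing

/-- Depth-two indices `m₁ > m₂ > 0` with `m₁` even and `m₂ ≡ c` modulo `2`, parametrised by
`m₂ = 2 s + c` and `m₁ - m₂ = 2 r + c`. -/
theorem levelTerm_pair_bijective {c : ℕ} (hc : c = 1 ∨ c = 2) (a : ZMod 2) (ha : a = c) :
    ∃ e : ℕ × ℕ ≃ levelIndex 2 ![0, a], ∀ x : ℕ × ℕ,
      ((e x : Fin 2 → ℕ) 0 = (2 * x.1 + c) + (2 * x.2 + c)) ∧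
      ((e x : Fin 2 → ℕ) 1 = 2 * x.2 + c) := by
  subst ha
  have h2 : ((2 : ℕ) : ZMod 2) = 0 := rfl
  let f : ℕ × ℕ → levelIndex 2 ![0, (c : ZMod 2)] := fun x =>
    ⟨![(2 * x.1 + c) + (2 * x.2 + c), 2 * x.2 + c], by
      refine ⟨?_, ?_, ?_⟩
      · intro i j hij
        fin_cases i <;> fin_cases j <;> simp at hij ⊢
        omega
      · intro i
        fin_cases i <;> simp <;> omega
      · intro i
        fin_cases i
        · change ((((2 * x.1 + c) + (2 * x.2 + c) : ℕ)) : ZMod 2) = 0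
          rw [ZMod.natCast_eq_zero_iff]
          omega
        · change (((2 * x.2 + c : ℕ)) : ZMod 2) = (c : ZMod 2)
          rw [ZMod.natCast_eq_natCast_iff']
          omega⟩
  have hf : Function.Bijective f := by
    constructor
    · rintro ⟨r, s⟩ ⟨r', s'⟩ h
      have h0 : (2 * r + c) + (2 * s + c) = (2 * r' + c) + (2 * s' + c) :=
        congrFun (congrArg Subtype.val h) 0
      have h1 : 2 * s + c = 2 * s' + c := congrFun (congrArg Subtype.val h) 1
      ext <;> simp <;> omega
    · rintro ⟨m, hm, hpos, hmod⟩
      have hlt : m 1 < m 0 := hm (by simp)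
      have hp := hpos 1
      have h0 : ((m 0 : ℕ) : ZMod 2) = 0 := hmod 0
      have h1 : ((m 1 : ℕ) : ZMod 2) = (c : ZMod 2) := hmod 1
      rw [ZMod.natCast_eq_zero_iff] at h0
      rw [ZMod.natCast_eq_natCast_iff'] at h1
      refine ⟨((m 0 - m 1 - c) / 2, (m 1 - c) / 2), Subtype.ext ?_⟩
      funext i
      fin_cases i
      · change (2 * ((m 0 - m 1 - c) / 2) + c) + (2 * ((m 1 - c) / 2) + c) = m 0
        omega
      · change 2 * ((m 1 - c) / 2) + c = m 1
        omega
  exact ⟨Equiv.ofBijective f hf, fun x => ⟨rfl, rfl⟩⟩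

theorem hasSum_levelZeta_pair {c : ℕ} (hc : c = 1 ∨ c = 2) (a : ZMod 2) (ha : a = c)
    {i l : ℕ} (hi : 2 ≤ i) (hl : 1 ≤ l) :
    HasSum (fun x : ℕ × ℕ =>
      1 / (((2 * x.1 + c : ℝ) + (2 * x.2 + c)) ^ i * (2 * x.2 + c : ℝ) ^ l))
      (levelZeta 2 ![i, l] ![0, a] / 4) := by
  obtain ⟨e, he⟩ := levelTerm_pair_bijective hc a ha
  have h : HasSum (fun m : levelIndex 2 ![0, a] => levelTerm 2 ![i, l] m)
      (levelZeta 2 ![i, l] ![0, a]) := (levelConverges_two hi hl 2 ![0, a]).hasSum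
  refine (congrArg (HasSum · _) (funext fun x => ?_)).mp ((e.hasSum_iff.2 h).div_const 4)
  simp only [Function.comp, levelTerm, Fin.prod_univ_two, Matrix.cons_val_zero,
    Matrix.cons_val_one, (he x).1, (he x).2]
  push_cast
  ring

theorem multipleT_one {k : ℕ} : multipleT ![k] = 2 * ∑' r : ℕ, 1 / (2 * r + 1 : ℝ) ^ k := by
  let f : ℕ → levelIndex 2 (fun i : Fin 1 => ((1 - (i : ℕ) : ℕ) : ZMod 2)) := fun r =>
    ⟨![2 * r + 1], by
      refine ⟨fun i j hij => ?_, fun i => ?_, fun i => ?_⟩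
      · exact absurd hij (by simp [Subsingleton.elim i j])
      · fin_cases i
        simp
      · fin_cases i
        change (((2 * r + 1 : ℕ)) : ZMod 2) = ((1 : ℕ) : ZMod 2)
        rw [ZMod.natCast_eq_natCast_iff']
        omega⟩
  have hf : Function.Bijective f := by
    constructor
    · intro r r' h
      have h0 : 2 * r + 1 = 2 * r' + 1 := congrFun (congrArg Subtype.val h) 0
      omega
    · rintro ⟨m, hm, hpos, hmod⟩
      have h0 : ((m 0 : ℕ) : ZMod 2) = ((1 : ℕ) : ZMod 2) := hmod 0
      rw [ZMod.natCast_eq_natCast_iff'] at h0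
      refine ⟨m 0 / 2, Subtype.ext ?_⟩
      funext i
      fin_cases i
      change 2 * (m 0 / 2) + 1 = m 0
      omega
  rw [multipleT, levelZeta, ← (Equiv.ofBijective f hf).tsum_eq, ← tsum_mul_left]
  refine tsum_congr fun r => ?_
  simp [f, levelTerm, div_eq_mul_inv]

end Reindexing

/-! ### The geometric sum and its symmetrisation -/

section Algebra

/-- The geometric sum behind the weights `2 ^ i`. -/
theorem sum_two_pow_div {p q : ℝ} (hp : 0 < p) (hq : 0 < q) (hpq : q ≠ p) (n : ℕ) :
    ∑ i ∈ range n, 2 ^ (i + 1) / ((p + q) ^ (i + 2) * q ^ (n - i)) =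
      ((2 / (p + q)) ^ (n + 1) - 1 / q ^ (n + 1)) / (q - p) - 1 / ((p + q) * q ^ (n + 1)) := by
  have hu : p + q ≠ 0 := by positivity
  have hq0 : q ≠ 0 := hq.ne'
  have hd : q - p ≠ 0 := sub_ne_zero.2 hpq
  induction n with
  | zero =>
    simp
    field_simp
    ring
  | succ n ih =>
    have h : ∑ i ∈ range n, 2 ^ (i + 1) / ((p + q) ^ (i + 2) * q ^ (n + 1 - i)) =
        (∑ i ∈ range n, 2 ^ (i + 1) / ((p + q) ^ (i + 2) * q ^ (n - i))) / q := by
      rw [sum_div]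
      refine sum_congr rfl fun i hi => ?_
      rw [Nat.succ_sub (mem_range.1 hi).le, pow_succ q]
      field_simp
    rw [sum_range_succ, h, ih]
    simp only [Nat.add_sub_cancel_left, div_pow]
    field_simp
    ring

/-- The summand of the weighted sum, symmetrised. -/
theorem sum_two_pow_symm {p q : ℝ} (hp : 0 < p) (hq : 0 < q) (n : ℕ) :
    ∑ i ∈ range n, 2 ^ (i + 1) * (1 / ((p + q) ^ (i + 2) * q ^ (n - i))
        + 1 / ((q + p) ^ (i + 2) * p ^ (n - i))) =
      1 / p ^ (n + 1) * (1 / (q - p) - 1 / (q + p)) +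
      1 / q ^ (n + 1) * (1 / (p - q) - 1 / (p + q)) +
      if p = q then (n + 1) / p ^ (n + 2) else 0 := by
  -- On the diagonal `1 / (p - p)` is 0 in Lean, so the first two summands total `-1 / p ^ (n + 2)`;
  -- the coefficient `n + 1` compensates.
  split_ifs with h
  · subst h
    have : ∀ i ∈ range n, 2 ^ (i + 1) * (1 / ((p + p) ^ (i + 2) * p ^ (n - i))
        + 1 / ((p + p) ^ (i + 2) * p ^ (n - i))) = 1 / p ^ (n + 2) := by
      intro i hi
      have e : p ^ (n + 2) = p ^ (i + 2) * p ^ (n - i) := by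
        rw [← pow_add]
        congr 1
        have := mem_range.1 hi
        omega
      rw [e, ← two_mul, ← two_mul, mul_pow, pow_succ 2 (i + 1)]
      field_simp
    rw [sum_congr rfl this]
    simp
    field_simp
    ring
  · have h1 := sum_two_pow_div hp hq (Ne.symm h) n
    have h2 := sum_two_pow_div hq hp h n
    have e : ∀ i ∈ range n, 2 ^ (i + 1) * (1 / ((p + q) ^ (i + 2) * q ^ (n - i))
        + 1 / ((q + p) ^ (i + 2) * p ^ (n - i))) =
        2 ^ (i + 1) / ((p + q) ^ (i + 2) * q ^ (n - i))
        + 2 ^ (i + 1) / ((q + p) ^ (i + 2) * p ^ (n - i)) := fun i _ => by ring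
    rw [sum_congr rfl e, sum_add_distrib, h1, h2, add_comm q p]
    have hd : q - p ≠ 0 := sub_ne_zero.2 (Ne.symm h)
    have hd' : p - q = -(q - p) := by ring
    rw [hd', div_neg, div_neg]
    field_simp
    ring

end Algebra

/-! ### Harmonic number estimates -/

section Harmonic

/-- The real harmonic number `1 + 1/2 + ⋯ + 1/n`. -/
noncomputable def realHarmonic (n : ℕ) : ℝ := ∑ i ∈ range n, 1 / ((i : ℝ) + 1)

/-- The term `s = r` is `1 / 0 = 0`; the `r` terms before it are negative reciprocals, the `t` after
it positive ones. -/
theorem sum_one_div_sub (r t : ℕ) :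
    ∑ s ∈ range (r + 1 + t), 1 / ((s : ℝ) - r) = realHarmonic t - realHarmonic r := by
  induction t with
  | zero =>
    rw [add_zero, sum_range_succ, realHarmonic, realHarmonic, ← sum_range_reflect]
    simp only [sub_self, div_zero, add_zero, range_zero, sum_empty, zero_sub, ← sum_neg_distrib]
    refine sum_congr rfl fun s hs => ?_
    have hs' := mem_range.1 hs
    have : ((r - 1 - s : ℕ) : ℝ) = r - 1 - s := by
      rw [Nat.cast_sub (by omega), Nat.cast_sub (by omega), Nat.cast_one]
    rw [this, ← one_div_neg_eq_neg_one_div]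
    congr 1
    ring
  | succ t ih =>
    rw [← add_assoc, sum_range_succ, ih, realHarmonic, realHarmonic, realHarmonic, sum_range_succ]
    have : ((r + 1 + t : ℕ) : ℝ) - r = t + 1 := by
      push_cast
      ring
    rw [this]
    ring

theorem sum_one_div_add (r N : ℕ) :
    ∑ s ∈ range N, 1 / ((s : ℝ) + r + 1) = realHarmonic (N + r) - realHarmonic r := by
  induction N with
  | zero => simp
  | succ N ih =>
    rw [sum_range_succ, ih, add_right_comm N 1 r, realHarmonic, realHarmonic, realHarmonic,
      sum_range_succ]
    push_cast
    ring

theorem realHarmonic_mono {a b : ℕ} (h : a ≤ b) : realHarmonic a ≤ realHarmonic b :=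
  sum_le_sum_of_subset_of_nonneg (range_mono h) fun i _ _ => by positivity

theorem realHarmonic_sub_le (a d : ℕ) :
    realHarmonic (a + d) - realHarmonic a ≤ d / ((a : ℝ) + 1) := by
  rw [add_comm a d, ← sum_one_div_add]
  calc ∑ s ∈ range d, 1 / ((s : ℝ) + a + 1) ≤ ∑ s ∈ range d, 1 / ((a : ℝ) + 1) := by
        refine sum_le_sum fun s _ => one_div_le_one_div_of_le (by positivity) ?_
        have : (0 : ℝ) ≤ s := s.cast_nonneg
        linarith
    _ = d / ((a : ℝ) + 1) := by
        rw [sum_const, card_range, nsmul_eq_mul]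
        ring

/-- By partial fractions the sum is `2 * realHarmonic N / (N + 1)`, bounded by twice a Cesàro mean
of a null sequence. -/
theorem tendsto_sum_one_div_mul :
    Tendsto (fun N : ℕ => ∑ r ∈ range N, 1 / (((r : ℝ) + 1) * ((N : ℝ) - r))) atTop (𝓝 0) := by
  have h1 : Tendsto (fun N : ℕ => (2 : ℝ) * ((N : ℝ)⁻¹ * ∑ i ∈ range N, 1 / ((i : ℝ) + 1)))
      atTop (𝓝 (2 * 0)) :=
    (tendsto_one_div_add_atTop_nhds_zero_nat (𝕜 := ℝ)).cesaro.const_mul 2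
  rw [mul_zero] at h1
  refine squeeze_zero (fun N => sum_nonneg fun r hr => ?_) (fun N => ?_) h1
  · have : (r : ℝ) < N := by exact_mod_cast mem_range.1 hr
    have : (0 : ℝ) < N - r := by linarith
    positivity
  · have e1 : ∀ r ∈ range N, 1 / (((r : ℝ) + 1) * ((N : ℝ) - r)) =
        ((N : ℝ) + 1)⁻¹ * (1 / ((r : ℝ) + 1) + 1 / ((N : ℝ) - r)) := by
      intro r hr
      have : (r : ℝ) < N := by exact_mod_cast mem_range.1 hr
      have h0 : (N : ℝ) - r ≠ 0 := by linarith
      field_simp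
      ring
    have e2 : ∑ r ∈ range N, 1 / ((N : ℝ) - r) = ∑ r ∈ range N, 1 / ((r : ℝ) + 1) := by
      rw [← sum_range_reflect]
      refine sum_congr rfl fun r hr => ?_
      have hr' := mem_range.1 hr
      rw [Nat.cast_sub (by omega), Nat.cast_sub (by omega), Nat.cast_one]
      congr 1
      ring
    rw [sum_congr rfl e1, ← mul_sum, sum_add_distrib, e2, ← two_mul, ← mul_assoc, mul_comm _ 2,
      mul_assoc]
    rcases Nat.eq_zero_or_pos N with rfl | hN
    · simp
    · have : (0 : ℝ) < N := by exact_mod_cast hN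
      gcongr
      linarith

end Harmonic

/-! ### Limits over squares and the weighted sum -/

section WeightedSum

/-- The inner sum, up to an error `O(p / (N - r))`, is `(c - 1) / p` for `p = 2 r + c`. -/
theorem abs_inner_sum_le {c : ℕ} (hc : c = 1 ∨ c = 2) {r N : ℕ} (hr : r < N) :
    |(∑ s ∈ range N, (1 / ((2 * s + c : ℝ) - (2 * r + c)) - 1 / ((2 * s + c : ℝ) + (2 * r + c))))
      - (c - 1) / (2 * r + c : ℝ)| ≤ (2 * r + c : ℝ) / ((N : ℝ) - r) := by
  obtain ⟨t, rfl⟩ := Nat.exists_eq_add_of_lt hr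
  obtain ⟨d, rfl⟩ : ∃ d, c = d + 1 := ⟨c - 1, by omega⟩
  have e1 : ∑ s ∈ range (r + t + 1), 1 / ((2 * s + (d + 1 : ℕ) : ℝ) - (2 * r + (d + 1 : ℕ))) =
      (realHarmonic t - realHarmonic r) / 2 := by
    rw [← sum_one_div_sub, add_right_comm, sum_div]
    refine sum_congr rfl fun s _ => ?_
    rw [div_div]
    congr 1
    ring
  have e2 : ∑ s ∈ range (r + t + 1), 1 / ((2 * s + (d + 1 : ℕ) : ℝ) + (2 * r + (d + 1 : ℕ))) =
      (realHarmonic (t + (2 * r + (d + 1))) - realHarmonic (r + d)) / 2 := by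
    have : t + (2 * r + (d + 1)) = r + t + 1 + (r + d) := by ring
    rw [this, ← sum_one_div_add, sum_div]
    refine sum_congr rfl fun s _ => ?_
    rw [div_div]
    congr 1
    push_cast
    ring
  -- The source of `c - 1`: this gap is empty for `c = 1` and is the single term `1 / (r + 1)` for
  -- `c = 2`.
  have e3 : realHarmonic (r + d) - realHarmonic r =
      2 * (((d + 1 : ℕ) : ℝ) - 1) / (2 * r + (d + 1 : ℕ) : ℝ) := by
    rcases hc with h | h
    · obtain rfl : d = 0 := by omega
      simp
    · obtain rfl : d = 1 := by omega
      rw [realHarmonic, sum_range_succ, realHarmonic, add_sub_cancel_left]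
      push_cast
      field_simp
      ring
  have h1 := realHarmonic_sub_le t (2 * r + (d + 1))
  have h2 : realHarmonic t ≤ realHarmonic (t + (2 * r + (d + 1))) :=
    realHarmonic_mono (Nat.le_add_right _ _)
  have e4 : ((r + t + 1 : ℕ) : ℝ) - r = t + 1 := by
    push_cast
    ring
  have e5 : ((2 * r + (d + 1) : ℕ) : ℝ) = 2 * r + (d + 1 : ℕ) := by push_cast; ring
  rw [e5] at h1
  rw [sum_sub_distrib, e1, e2, e4]
  have e6 : (realHarmonic t - realHarmonic r) / 2 -
      (realHarmonic (t + (2 * r + (d + 1))) - realHarmonic (r + d)) / 2 -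
      (((d + 1 : ℕ) : ℝ) - 1) / (2 * r + (d + 1 : ℕ) : ℝ) =
      -((realHarmonic (t + (2 * r + (d + 1))) - realHarmonic t) / 2) := by
    rw [mul_div_assoc] at e3
    linarith
  rw [e6, abs_neg, abs_of_nonneg (by linarith)]
  linarith

theorem summable_one_div_two_mul_add_pow (c : ℕ) {k : ℕ} (hk : 2 ≤ k) :
    Summable fun r : ℕ => 1 / (2 * r + c : ℝ) ^ k := by
  have h : Summable fun n : ℕ => 1 / (n : ℝ) ^ k := Real.summable_one_div_nat_pow.2 (by omega)
  have hinj : Function.Injective fun r : ℕ => 2 * r + c := fun r r' hr => by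
    simp at hr
    exact hr
  refine (h.comp_injective hinj).congr fun r => ?_
  simp

/-- For `p = 2 r + c` the inner error costs at most `1 / (p ^ n * (N - r))`. As `n ≥ 1` and `p ≥ r +
1`, `tendsto_sum_one_div_mul` dominates it. -/
theorem tendsto_sum_inner {c : ℕ} (hc : c = 1 ∨ c = 2) (n : ℕ) (hn : 1 ≤ n) :
    Tendsto (fun N : ℕ => ∑ r ∈ range N, 1 / (2 * r + c : ℝ) ^ (n + 1) *
      ∑ s ∈ range N, (1 / ((2 * s + c : ℝ) - (2 * r + c)) - 1 / ((2 * s + c : ℝ) + (2 * r + c))))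
      atTop (𝓝 ((c - 1) * ∑' r : ℕ, 1 / (2 * r + c : ℝ) ^ (n + 2))) := by
  have hc1 : 1 ≤ c := by omega
  have hc1' : (1 : ℝ) ≤ c := by exact_mod_cast hc1
  have hmain : Tendsto (fun N : ℕ => ((c : ℝ) - 1) * ∑ r ∈ range N, 1 / (2 * r + c : ℝ) ^ (n + 2))
      atTop (𝓝 ((c - 1) * ∑' r : ℕ, 1 / (2 * r + c : ℝ) ^ (n + 2))) :=
    (summable_one_div_two_mul_add_pow c (by omega)).hasSum.tendsto_sum_nat.const_mul _
  refine tendsto_of_tendsto_of_dist hmain ?_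
  refine squeeze_zero (fun _ => dist_nonneg) (fun N => ?_) tendsto_sum_one_div_mul
  rw [dist_comm, Real.dist_eq, mul_sum, ← sum_sub_distrib]
  refine (abs_sum_le_sum_abs _ _).trans (sum_le_sum fun r hr => ?_)
  have hr' : (r : ℝ) < N := by exact_mod_cast mem_range.1 hr
  have hr0 : (0 : ℝ) ≤ r := r.cast_nonneg
  have hNr : (0 : ℝ) < N - r := by linarith
  have hp : (1 : ℝ) ≤ 2 * r + c := by linarith
  have hp0 : (0 : ℝ) < 2 * r + c := by linarith
  have e : ∀ A : ℝ, 1 / (2 * r + c : ℝ) ^ (n + 1) * A - (c - 1) * (1 / (2 * r + c : ℝ) ^ (n + 2)) =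
      1 / (2 * r + c : ℝ) ^ (n + 1) * (A - (c - 1) / (2 * r + c : ℝ)) := by
    intro A
    rw [pow_succ _ (n + 1)]
    field_simp
  rw [e, abs_mul, abs_of_nonneg (by positivity)]
  calc _ ≤ 1 / (2 * r + c : ℝ) ^ (n + 1) * ((2 * r + c : ℝ) / ((N : ℝ) - r)) := by
        gcongr
        exact abs_inner_sum_le hc (mem_range.1 hr)
    _ = 1 / ((2 * r + c : ℝ) ^ n * ((N : ℝ) - r)) := by
        rw [pow_succ]
        field_simp
    _ ≤ 1 / (((r : ℝ) + 1) * ((N : ℝ) - r)) := by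
        refine one_div_le_one_div_of_le (by positivity) ?_
        gcongr
        exact le_trans (by linarith) (le_self_pow₀ hp (by omega))

theorem tendsto_sum_symm {c : ℕ} (hc : c = 1 ∨ c = 2) (n : ℕ) (hn : 1 ≤ n) :
    Tendsto (fun N : ℕ => ∑ x ∈ range N ×ˢ range N, ∑ i ∈ range n, (2 : ℝ) ^ (i + 1) *
      (1 / (((2 * x.1 + c : ℝ) + (2 * x.2 + c)) ^ (i + 2) * (2 * x.2 + c : ℝ) ^ (n - i)) +
       1 / (((2 * x.2 + c : ℝ) + (2 * x.1 + c)) ^ (i + 2) * (2 * x.1 + c : ℝ) ^ (n - i))))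
      atTop (𝓝 ((n + 1 + 2 * (c - 1)) * ∑' r : ℕ, 1 / (2 * r + c : ℝ) ^ (n + 2))) := by
  have hc1 : 1 ≤ c := by omega
  have hc0 : (0 : ℝ) < c := by exact_mod_cast hc1
  have h1 := tendsto_sum_inner hc n hn
  have h2 : Tendsto (fun N : ℕ => ((n : ℝ) + 1) * ∑ r ∈ range N, 1 / (2 * r + c : ℝ) ^ (n + 2))
      atTop (𝓝 ((n + 1) * ∑' r : ℕ, 1 / (2 * r + c : ℝ) ^ (n + 2))) :=
    (summable_one_div_two_mul_add_pow c (by omega)).hasSum.tendsto_sum_nat.const_mul _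
  convert (h1.add h1).add h2 using 1
  · funext N
    rw [sum_congr rfl fun x _ => sum_two_pow_symm (p := 2 * x.1 + c) (q := 2 * x.2 + c)
      (by positivity) (by positivity) n]
    -- The mirror term is summed in the opposite order, which turns it into a second copy of the
    -- first.
    rw [sum_add_distrib, sum_add_distrib, sum_product, sum_product_right, sum_product, mul_sum]
    congr 1
    · congr 1 <;> exact sum_congr rfl fun r _ => by rw [mul_sum]
    · refine sum_congr rfl fun r hr => ?_
      simp only [add_left_inj, mul_eq_mul_left_iff, Nat.cast_inj, OfNat.ofNat_ne_zero, or_false]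
      rw [sum_ite_eq, if_pos hr]
      ring
  · congr 1
    ring

theorem tendsto_sum_range_product {f : ℕ × ℕ → ℝ} {a : ℝ} (h : HasSum f a) :
    Tendsto (fun N : ℕ => ∑ x ∈ range N ×ˢ range N, f x) atTop (𝓝 a) := by
  have hlim : Tendsto (fun N : ℕ => range N ×ˢ range N) atTop atTop := by
    refine tendsto_finsetProd_atTop.comp (f := fun N : ℕ => (range N, range N)) ?_
    rw [← prod_atTop_atTop_eq]
    exact tendsto_finset_range.prodMk tendsto_finset_range
  rw [HasSum, SummationFilter.unconditional_filter] at h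
  exact h.comp hlim

/-- The weighted sum formula of level two, with both parities of the smaller variable. -/
theorem sum_two_pow_mul_levelZeta {c : ℕ} (hc : c = 1 ∨ c = 2) (a : ZMod 2) (ha : a = c)
    (n : ℕ) (hn : 1 ≤ n) :
    ∑ i ∈ range n, (2 : ℝ) ^ (i + 2) * levelZeta 2 ![i + 2, n - i] ![0, a] =
      4 * ((n + 1 + 2 * (c - 1)) * ∑' r : ℕ, 1 / (2 * r + c : ℝ) ^ (n + 2)) := by
  have h : HasSum (fun x : ℕ × ℕ => ∑ i ∈ range n, (2 : ℝ) ^ (i + 1) *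
      (1 / (((2 * x.1 + c : ℝ) + (2 * x.2 + c)) ^ (i + 2) * (2 * x.2 + c : ℝ) ^ (n - i)) +
       1 / (((2 * x.2 + c : ℝ) + (2 * x.1 + c)) ^ (i + 2) * (2 * x.1 + c : ℝ) ^ (n - i))))
      (∑ i ∈ range n, (2 : ℝ) ^ (i + 1) * (levelZeta 2 ![i + 2, n - i] ![0, a] / 4 +
        levelZeta 2 ![i + 2, n - i] ![0, a] / 4)) := by
    refine hasSum_sum fun i hi => ?_
    have hi' := mem_range.1 hi
    have h0 := hasSum_levelZeta_pair hc a ha (i := i + 2) (l := n - i) (by omega) (by omega)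
    -- Swapping `p` and `q` preserves the sum, so symmetrising just doubles it.
    have h1 := (Equiv.prodComm ℕ ℕ).hasSum_iff.2 h0
    exact (h0.add h1).mul_left _
  have := tendsto_nhds_unique (tendsto_sum_range_product h) (tendsto_sum_symm hc n hn)
  rw [← this, mul_sum]
  refine sum_congr rfl fun i _ => ?_
  ring

end WeightedSum

/-! ### Even and odd power sums in terms of `ζ(k)` -/

section Zeta

theorem tsum_one_div_even_pow (k : ℕ) :
    ∑' r : ℕ, 1 / (2 * r + 2 : ℝ) ^ k = 1 / 2 ^ k * ∑' n : ℕ, 1 / ((n : ℝ) + 1) ^ k := by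
  rw [← tsum_mul_left]
  refine tsum_congr fun r => ?_
  rw [div_mul_div_comm, one_mul, ← mul_pow]
  ring_nf

theorem tsum_one_div_odd_pow {k : ℕ} (hk : 2 ≤ k) :
    ∑' r : ℕ, 1 / (2 * r + 1 : ℝ) ^ k = (1 - 1 / 2 ^ k) * ∑' n : ℕ, 1 / ((n : ℝ) + 1) ^ k := by
  have h1 := summable_one_div_two_mul_add_pow 1 hk
  have h2 := summable_one_div_two_mul_add_pow 2 hk
  have h := tsum_even_add_odd (f := fun n : ℕ => 1 / ((n : ℝ) + 1) ^ k)
    (by simpa using h1) (by simpa [add_assoc, one_add_one_eq_two] using h2)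
  have e := tsum_one_div_even_pow k
  have e' : ∑' r : ℕ, 1 / (((2 * r + 1 : ℕ) : ℝ) + 1) ^ k = ∑' r : ℕ, 1 / (2 * r + 2 : ℝ) ^ k :=
    tsum_congr fun r => by push_cast; ring_nf
  rw [e', e] at h
  push_cast at h
  linarith

theorem riemannZeta_eq_ofReal {k : ℕ} (hk : 2 ≤ k) :
    riemannZeta k = ((∑' n : ℕ, 1 / ((n : ℝ) + 1) ^ k : ℝ) : ℂ) := by
  rw [zeta_eq_tsum_one_div_nat_add_one_cpow (by simp; omega)]
  push_cast
  exact tsum_congr fun n => by rw [Complex.cpow_natCast]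

end Zeta

theorem mainTheorem8 (k : ℕ) (hk : 3 ≤ k) :
    -- all the series involved converge
    ((∀ j ∈ Finset.Icc 2 (k - 1), ∀ a : Fin 2 → ZMod 2, LevelConverges 2 ![j, k - j] a) ∧
      ∀ a : Fin 1 → ZMod 2, LevelConverges 2 ![k] a) ∧
    -- the two weighted sum formulas of level 2
    ((∑ j ∈ Finset.Icc 2 (k - 1), (2 : ℝ) ^ j * levelZeta 2 ![j, k - j] ![0, 0] : ℝ) : ℂ) =
      ((k : ℂ) + 1) / 2 ^ (k - 2) * riemannZeta k ∧
    ((∑ j ∈ Finset.Icc 2 (k - 1), (2 : ℝ) ^ j * levelZeta 2 ![j, k - j] ![0, 1] : ℝ) : ℂ) =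
      4 * ((k : ℂ) - 1) * (1 - 1 / 2 ^ k) * riemannZeta k ∧
    -- the weighted sum formula of double T-values
    ∑ j ∈ Finset.Icc 2 (k - 1), (2 : ℝ) ^ (j - 1) * multipleT ![j, k - j] =
      ((k : ℝ) - 1) * multipleT ![k] := by
  obtain ⟨n, rfl⟩ : ∃ n, k = n + 2 := ⟨k - 2, by omega⟩
  have hn : 1 ≤ n := by omega
  have hsum : ∀ f : ℕ → ℝ, ∑ j ∈ Finset.Icc 2 (n + 2 - 1), f j = ∑ i ∈ range n, f (i + 2) := by
    intro f
    rw [range_eq_Ico, sum_Ico_add' f 0 n 2]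
    refine sum_congr ?_ fun _ _ => rfl
    ext j
    simp only [mem_Icc, mem_Ico]
    omega
  have heven := sum_two_pow_mul_levelZeta (Or.inr rfl) 0 rfl n hn
  have hodd := sum_two_pow_mul_levelZeta (Or.inl rfl) 1 (by simp) n hn
  simp only [Nat.cast_ofNat, Nat.cast_one] at heven hodd
  refine ⟨⟨fun j hj a => ?_, fun a => levelConverges_one (by omega) 2 a⟩, ?_, ?_, ?_⟩
  · have := mem_Icc.1 hj
    exact levelConverges_two (by omega) (by omega) 2 a
  · rw [hsum]
    simp only [Nat.add_sub_add_right]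
    rw [heven, tsum_one_div_even_pow, riemannZeta_eq_ofReal (by omega)]
    push_cast
    rw [pow_add]
    field_simp
    ring
  · rw [hsum]
    simp only [Nat.add_sub_add_right]
    rw [hodd, tsum_one_div_odd_pow (by omega), riemannZeta_eq_ofReal (by omega)]
    push_cast
    ring
  · have hT : ∀ j l : ℕ, multipleT ![j, l] = levelZeta 2 ![j, l] ![0, 1] := by
      intro j l
      rw [multipleT]
      congr 1
      funext i
      fin_cases i <;> rfl
    rw [hsum, multipleT_one]
    simp only [hT, Nat.add_sub_add_right]
    have e : ∀ i ∈ range n, (2 : ℝ) ^ (i + 2 - 1) * levelZeta 2 ![i + 2, n - i] ![0, 1] =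
        (2 : ℝ) ^ (i + 2) * levelZeta 2 ![i + 2, n - i] ![0, 1] / 2 := by
      intro i _
      rw [show i + 2 - 1 = i + 1 from rfl, pow_succ 2 (i + 1)]
      ring
    rw [sum_congr rfl e, ← sum_div, hodd]
    push_cast
    ring
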